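/- Let $R$ be a commutative ring with $2\in R^\times$ and let $n\ge 3$. Let $Um_n(R)$ be the set of vectors $v\in R^n$ whose entries generate the unit ideal, with the action of $SL_n(R)$ by matrix multiplication. Let $H(R^n)=R^n\oplus R^n$ with the quadratic form $q(a,b)=\sum_i a_ib_i$, let $U_{2n-1}(R)=\{(a,b)\in H(R^n) : q(a,b)=1\}$, and let $Cl=Cl_0\oplus Cl_1$ be the Clifford algebra of $(H(R^n),q)$ with its standard involution $*$ (the anti-automorphism with $x^*=-x$ for $x\in H(R^n)$). Put $$Spin_{2n}(R)=\{g\in Cl_0 : gg^*=1,\ gH(R^n)g^{-1}=H(R^n)\},$$ acting on $U_{2n-1}(R)$ by $g\cdot x=gxg^{-1}$, and write $St(x,y)\le Spin_{2n}(R)$ for the stabilizer of $(x,y)\in U_{2n-1}(R)$. Let $\wedge:SL_n(R)\to Spin_{2n}(R)$ be the homomorphism sending $\sigma$ to the element corresponding to the automorphism $\bigwedge\sigma$ of the exterior algebra under the isomorphism $Cl\cong \mathrm{End}_R(\bigwedge R^n)$ given by $(a,b)\mapsto a\wedge(-)+(\text{contraction by } b)$; it lifts $\sigma\mapsto \mathrm{diag}(\sigma,(\sigma^t)^{-1})$.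 Let $Epin_{2n}(R)\le Spin_{2n}(R)$ be the elementary Spin group, generated by the elements $1+r\,\epsilon_i\epsilon_j$, $1+r\,\epsilon_i\phi_j$, $1+r\,\phi_i\phi_j$ ($i\ne j$, $r\in R$), where $\epsilon_1,\dots,\epsilon_n$ and $\phi_1,\dots,\phi_n$ are the standard bases of the two summands of $H(R^n)$. Products of subgroups are sets of products. There is a natural surjective comparison map $Um_n(R)/SL_n(R)\to U_{2n-1}(R)/Spin_{2n}(R)$, sending the orbit of $v$ to the orbit of $(v,w)$ for any $w\in R^n$ with $\sum_i v_iw_i=1$. **Theorem.** The comparison map is injective (and hence bijective) if and only if $$Spin_{2n}(R)=\wedge(SL_n(R))\,Epin_{2n}(R)\,St(x,y)\quad\text{for every } (x,y)\in U_{2n-1}(R).$$ Furthermore, $Um_n(R)/SL_n(R)$ is trivial (has exactly one element) if and only if $U_{2n-1}(R)/Spin_{2n}(R)$ is trivial and $Spin_{2n}(R)=\wedge(SL_n(R))\,Epin_{2n}(R)\,St(u_n)$, where $u_n=(e_n,e_n)$ and $e_n=(1,0,\dots,0)^t\in R^n$. -/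

import Mathlib

namespace SpinOrbit

open scoped Matrix

variable {n : ℕ} {R : Type*} [CommRing R]

/-! ### The hyperbolic space and its Clifford algebra -/

/-- The underlying module `Rⁿ ⊕ Rⁿ` of the hyperbolic space `H(Rⁿ)`. -/
abbrev V (n : ℕ) (R : Type*) [CommRing R] : Type _ := (Fin n → R) × (Fin n → R)

/-- The hyperbolic quadratic form `q(a, b) = ∑ aᵢ bᵢ`. -/
def q (n : ℕ) (R : Type*) [CommRing R] : QuadraticForm R (V n R) :=
  LinearMap.BilinMap.toQuadraticMap
    (LinearMap.mk₂ R (fun x y : V n R => x.1 ⬝ᵥ y.2)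
      (fun x x' y => by simp [add_dotProduct]) (fun c x y => by simp [smul_dotProduct])
      (fun x y y' => by simp [dotProduct_add]) (fun c x y => by simp [dotProduct_smul]))

theorem q_apply (x : V n R) : q n R x = x.1 ⬝ᵥ x.2 := rfl

theorem polar_q (x y : V n R) :
    QuadraticMap.polar (q n R) x y = x.1 ⬝ᵥ y.2 + y.1 ⬝ᵥ x.2 := by
  simp only [QuadraticMap.polar, q_apply, Prod.fst_add, Prod.snd_add, add_dotProduct,
    dotProduct_add]
  ring

/-- The Clifford algebra of the hyperbolic space. -/
abbrev Cl (n : ℕ) (R : Type*) [CommRing R] : Type _ := CliffordAlgebra (q n R)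

/-- The inclusion of the hyperbolic space into its Clifford algebra. -/
abbrev inc (n : ℕ) (R : Type*) [CommRing R] : V n R →ₗ[R] Cl n R := CliffordAlgebra.ι (q n R)

/-! ### Unimodular vectors and unit vectors -/

/-- Unimodular vectors of length `n`. -/
def Um (n : ℕ) (R : Type*) [CommRing R] : Type _ :=
  {v : Fin n → R // Ideal.span (Set.range v) = ⊤}

/-- The unit vectors of the hyperbolic space (the set written `U_{2n-1}(R)`). -/
def UnitVec (n : ℕ) (R : Type*) [CommRing R] : Type _ := {x : V n R // q n R x = 1}

theorem span_range_eq_top_iff (v : Fin n → R) :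
    Ideal.span (Set.range v) = ⊤ ↔ ∃ w : Fin n → R, v ⬝ᵥ w = 1 := by
  rw [Ideal.eq_top_iff_one, Ideal.mem_span_range_iff_exists_fun]
  constructor
  · rintro ⟨c, hc⟩; exact ⟨c, by rw [dotProduct_comm]; exact hc⟩
  · rintro ⟨c, hc⟩; exact ⟨c, by rw [dotProduct_comm] at hc; exact hc⟩

theorem inv_mul_val (σ : Matrix.SpecialLinearGroup (Fin n) R) :
    (σ⁻¹).1 * σ.1 = 1 := by
  rw [← Matrix.SpecialLinearGroup.coe_mul, inv_mul_cancel, Matrix.SpecialLinearGroup.coe_one]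

theorem dotProduct_contragredient (σ : Matrix.SpecialLinearGroup (Fin n) R) (v w : Fin n → R) :
    (σ.1 *ᵥ v) ⬝ᵥ ((σ⁻¹).1ᵀ *ᵥ w) = v ⬝ᵥ w := by
  rw [Matrix.mulVec_transpose, dotProduct_comm, ← Matrix.dotProduct_mulVec, Matrix.mulVec_mulVec,
    inv_mul_val, Matrix.one_mulVec, dotProduct_comm]

/-- `SLₙ(R)` acts on unimodular (column) vectors by matrix multiplication. -/
instance : MulAction (Matrix.SpecialLinearGroup (Fin n) R) (Um n R) where
  smul σ v := ⟨σ.1 *ᵥ v.1, by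
    obtain ⟨w, hw⟩ := (span_range_eq_top_iff _).1 v.2
    exact (span_range_eq_top_iff _).2 ⟨(σ⁻¹).1ᵀ *ᵥ w, by rw [dotProduct_contragredient, hw]⟩⟩
  one_smul v := Subtype.ext (Matrix.one_mulVec v.1)
  mul_smul σ τ v := Subtype.ext (Matrix.mulVec_mulVec v.1 σ.1 τ.1).symm

theorem Um.coe_smul (σ : Matrix.SpecialLinearGroup (Fin n) R) (v : Um n R) :
    (σ • v).1 = σ.1 *ᵥ v.1 := rfl

/-! ### The isomorphism `Cl(H(Rⁿ)) ≅ End(⋀ Rⁿ)` -/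

/-- The exterior algebra of `Rⁿ`. -/
abbrev Ext (n : ℕ) (R : Type*) [CommRing R] : Type _ := ExteriorAlgebra R (Fin n → R)

/-- The pairing of the second summand of `H(Rⁿ)` with the first one. -/
def pair (n : ℕ) (R : Type*) [CommRing R] : (Fin n → R) →ₗ[R] Module.Dual R (Fin n → R) :=
  LinearMap.mk₂ R (fun b a => a ⬝ᵥ b)
      (fun x x' y => by simp [dotProduct_add]) (fun c x y => by simp [dotProduct_smul])
      (fun x y y' => by simp [add_dotProduct]) (fun c x y => by simp [smul_dotProduct])

theorem pair_apply (b a : Fin n → R) : pair n R b a = a ⬝ᵥ b := rfl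

/-- `(a, b)` acts on `⋀ Rⁿ` as left exterior multiplication by `a` plus contraction by `b`. -/
def fockAux (n : ℕ) (R : Type*) [CommRing R] : V n R →ₗ[R] Module.End R (Ext n R) :=
  LinearMap.coprod ((Algebra.lmul R (Ext n R)).toLinearMap ∘ₗ ExteriorAlgebra.ι R)
    (CliffordAlgebra.contractLeft ∘ₗ pair n R)

theorem fockAux_apply (x : V n R) (m : Ext n R) :
    fockAux n R x m =
      ExteriorAlgebra.ι R x.1 * m + CliffordAlgebra.contractLeft (pair n R x.2) m := rfl

theorem contract_ι_mul (d : Module.Dual R (Fin n → R)) (a : Fin n → R) (m : Ext n R) :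
    CliffordAlgebra.contractLeft d (ExteriorAlgebra.ι R a * m) =
      d a • m - ExteriorAlgebra.ι R a * CliffordAlgebra.contractLeft d m :=
  CliffordAlgebra.contractLeft_ι_mul d a m

theorem ι_mul_ι_mul_self (a : Fin n → R) (m : Ext n R) :
    ExteriorAlgebra.ι R a * (ExteriorAlgebra.ι R a * m) = 0 := by
  rw [← mul_assoc, ExteriorAlgebra.ι_sq_zero, zero_mul]

/-- The spinor representation of the Clifford algebra on the exterior algebra. -/
def fock (n : ℕ) (R : Type*) [CommRing R] : Cl n R →ₐ[R] Module.End R (Ext n R) :=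
  CliffordAlgebra.lift (q n R) ⟨fockAux n R, fun x => by
    refine LinearMap.ext fun m => ?_
    rw [Module.End.mul_apply, fockAux_apply, fockAux_apply, Module.algebraMap_end_apply, mul_add,
      ι_mul_ι_mul_self, map_add, contract_ι_mul, CliffordAlgebra.contractLeft_contractLeft,
      pair_apply, q_apply]
    abel⟩

theorem fock_inc (x : V n R) (m : Ext n R) :
    fock n R (inc n R x) m =
      ExteriorAlgebra.ι R x.1 * m + CliffordAlgebra.contractLeft (pair n R x.2) m := by
  rw [fock, inc, CliffordAlgebra.lift_ι_apply, fockAux_apply]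

theorem inc_injective : Function.Injective (inc n R) := by
  rw [injective_iff_map_eq_zero]
  rintro ⟨a, b⟩ h
  have h1 := fock_inc (a, b) (1 : Ext n R)
  rw [h, map_zero, LinearMap.zero_apply, mul_one, CliffordAlgebra.contractLeft_one, add_zero,
    eq_comm, ExteriorAlgebra.ι_eq_zero_iff] at h1
  obtain rfl : a = 0 := h1
  have hb : b = 0 := by
    funext i
    have h2 := fock_inc ((0 : Fin n → R), b) (ExteriorAlgebra.ι R (Pi.single i 1))
    rw [h, map_zero, LinearMap.zero_apply, map_zero, zero_mul, zero_add] at h2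
    have h3 := h2.trans (CliffordAlgebra.contractLeft_ι _ _ _)
    rw [eq_comm] at h3
    have h4 := (ExteriorAlgebra.algebraMap_eq_zero_iff (M := Fin n → R) _).1 h3
    simpa [pair_apply] using h4
  rw [hb]; rfl

theorem algebraMap_injective : Function.Injective (algebraMap R (Cl n R)) := by
  rw [injective_iff_map_eq_zero]
  intro r h
  have h1 : fock n R (algebraMap R (Cl n R) r) 1 = algebraMap R (Ext n R) r := by
    rw [AlgHom.commutes, Module.algebraMap_end_apply, Algebra.algebraMap_eq_smul_one]
  rw [h, map_zero, LinearMap.zero_apply, eq_comm] at h1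
  exact (ExteriorAlgebra.algebraMap_eq_zero_iff (M := Fin n → R) _).1 h1

/-- The basis vectors of the first summand, in the Clifford algebra. -/
def e (n : ℕ) (R : Type*) [CommRing R] (i : Fin n) : Cl n R := inc n R (Pi.single i 1, 0)

/-- The basis vectors of the second summand, in the Clifford algebra. -/
def f (n : ℕ) (R : Type*) [CommRing R] (i : Fin n) : Cl n R := inc n R (0, Pi.single i 1)

theorem inc_anticomm (x y : V n R) (h : QuadraticMap.polar (q n R) x y = 0) :
    inc n R x * inc n R y = -(inc n R y * inc n R x) := by
  have := CliffordAlgebra.ι_mul_ι_add_swap (Q := q n R) x y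
  rw [h, map_zero] at this
  exact eq_neg_of_add_eq_zero_left this

theorem e_mul_f_self (i : Fin n) : e n R i * f n R i + f n R i * e n R i = 1 := by
  rw [e, f, inc, CliffordAlgebra.ι_mul_ι_add_swap, polar_q]
  simp

theorem e_mul_f_ne {i j : Fin n} (h : i ≠ j) : e n R i * f n R j = -(f n R j * e n R i) :=
  inc_anticomm _ _ (by rw [polar_q]; simp [h.symm])

theorem f_mul_f (i j : Fin n) : f n R i * f n R j = -(f n R j * f n R i) :=
  inc_anticomm _ _ (by rw [polar_q]; simp)

theorem f_sq (i : Fin n) : f n R i * f n R i = 0 := by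
  rw [f, inc, CliffordAlgebra.ι_sq_scalar, q_apply]; simp

/-- The product of the `fᵢ` along a list of indices. -/
def fprod (n : ℕ) (R : Type*) [CommRing R] (L : List (Fin n)) : Cl n R := (L.map (f n R)).prod

theorem fprod_cons (i : Fin n) (L : List (Fin n)) :
    fprod n R (i :: L) = f n R i * fprod n R L := by simp [fprod]

theorem e_mul_fprod {i : Fin n} {L : List (Fin n)} (h : i ∉ L) :
    e n R i * fprod n R L = (-1) ^ L.length * (fprod n R L * e n R i) := by
  induction L with
  | nil => simp [fprod]
  | cons j L ih =>
    rw [List.mem_cons, not_or] at h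
    rw [fprod_cons, ← mul_assoc, e_mul_f_ne h.1, neg_mul, mul_assoc, ih h.2, List.length_cons,
      ← mul_assoc (f n R j), ((Commute.neg_one_right (f n R j)).pow_right _).eq]
    simp only [pow_succ, mul_assoc, neg_mul, mul_neg, one_mul]

theorem f_mul_fprod {i : Fin n} {L : List (Fin n)} (h : i ∈ L) : f n R i * fprod n R L = 0 := by
  induction L with
  | nil => simp at h
  | cons j L ih =>
    rw [fprod_cons]
    rcases List.mem_cons.1 h with rfl | h
    · rw [← mul_assoc, f_sq, zero_mul]
    · rw [← mul_assoc, f_mul_f, neg_mul, mul_assoc, ih h, mul_zero, neg_zero]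

/-- Descent along the idempotents `eᵢ fᵢ` and `fᵢ eᵢ`, in an algebra over the Clifford algebra. -/
theorem descent {A : Type*} [Ring A] (φ : Cl n R →+* A) (S : Set A) (N : AddSubgroup A)
    (hS : ∀ x ∈ S, ∀ i, x * φ (e n R i) ∈ S) (hN : ∀ x ∈ N, ∀ i, x * φ (e n R i) ∈ N)
    (L : List (Fin n)) (hL : L.Nodup) (h : ∀ x ∈ S, x * φ (fprod n R L) ∈ N) :
    ∀ x ∈ S, x ∈ N := by
  induction L with
  | nil => intro x hx; simpa [fprod] using h x hx
  | cons k L ih =>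
    rw [List.nodup_cons] at hL
    refine ih hL.2 fun x hx => ?_
    have key : fprod n R L = e n R k * fprod n R (k :: L)
        + (-1) ^ L.length * (fprod n R (k :: L) * e n R k) := by
      rw [fprod_cons, mul_assoc, ← mul_assoc, ← mul_assoc ((-1) ^ L.length),
        ← ((Commute.neg_one_right (f n R k)).pow_right _).eq, mul_assoc (f n R k),
        ← e_mul_fprod hL.1, ← mul_assoc, ← add_mul, e_mul_f_self, one_mul]
    have h2 : x * φ (fprod n R (k :: L) * e n R k) ∈ N := by
      rw [map_mul, ← mul_assoc]; exact hN _ (h x hx) k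
    rw [key, map_add, mul_add, map_mul, ← mul_assoc]
    refine N.add_mem (h _ (hS x hx k)) ?_
    rcases neg_one_pow_eq_or (Cl n R) L.length with hs | hs
    · rw [hs, one_mul]; exact h2
    · rw [hs, neg_one_mul, map_neg, mul_neg]; exact N.neg_mem h2

/-- The canonical algebra map `⋀ Rⁿ → Cl(H(Rⁿ))` from the first summand. -/
def extInl (n : ℕ) (R : Type*) [CommRing R] : Ext n R →ₐ[R] Cl n R :=
  ExteriorAlgebra.lift R ⟨inc n R ∘ₗ LinearMap.inl R _ _, fun a => by
    rw [LinearMap.comp_apply, inc, CliffordAlgebra.ι_sq_scalar, q_apply]; simp⟩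

/-- The canonical algebra map `⋀ Rⁿ → Cl(H(Rⁿ))` from the second summand. -/
def extInr (n : ℕ) (R : Type*) [CommRing R] : Ext n R →ₐ[R] Cl n R :=
  ExteriorAlgebra.lift R ⟨inc n R ∘ₗ LinearMap.inr R _ _, fun a => by
    rw [LinearMap.comp_apply, inc, CliffordAlgebra.ι_sq_scalar, q_apply]; simp⟩

theorem extInl_ι (a : Fin n → R) : extInl n R (ExteriorAlgebra.ι R a) = inc n R (a, 0) :=
  ExteriorAlgebra.lift_ι_apply _ _ _ _

theorem extInr_ι (a : Fin n → R) : extInr n R (ExteriorAlgebra.ι R a) = inc n R (0, a) :=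
  ExteriorAlgebra.lift_ι_apply _ _ _ _

theorem fock_extInl (m m' : Ext n R) : fock n R (extInl n R m) m' = m * m' := by
  have : (fock n R).comp (extInl n R) = Algebra.lmul R (Ext n R) := by
    refine ExteriorAlgebra.hom_ext (LinearMap.ext fun a => LinearMap.ext fun m => ?_)
    change fock n R (extInl n R (ExteriorAlgebra.ι R a)) m = ExteriorAlgebra.ι R a * m
    rw [extInl_ι, fock_inc]; simp
  exact LinearMap.congr_fun (AlgHom.congr_fun this m) m'

theorem inc_inr_eq_sum (b : Fin n → R) : inc n R (0, b) = ∑ i, b i • f n R i := by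
  simp only [f, ← map_smul, ← map_sum]
  congr 1
  refine Prod.ext ?_ ?_
  · simp [Prod.fst_sum]
  · rw [Prod.snd_sum]
    simp only [Prod.smul_snd]
    exact pi_eq_sum_univ' b

theorem inc_add (x : V n R) : inc n R x = inc n R (x.1, 0) + inc n R (0, x.2) := by
  rw [← map_add]; simp

theorem mul_extInl_mul_fprod (L : List (Fin n)) (hL : ∀ i, i ∈ L) (c : Cl n R) (m : Ext n R) :
    c * (extInl n R m * fprod n R L) = extInl n R (fock n R c m) * fprod n R L := by
  induction c using CliffordAlgebra.induction generalizing m with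
  | algebraMap r =>
    rw [AlgHom.commutes, Module.algebraMap_end_apply, map_smul, Algebra.smul_def, mul_assoc]
  | ι x =>
    have hb : ∀ m : Ext n R, inc n R (0, x.2) * (extInl n R m * fprod n R L) =
        extInl n R (CliffordAlgebra.contractLeft (pair n R x.2) m) * fprod n R L := by
      intro m
      induction m using CliffordAlgebra.left_induction with
      | algebraMap r =>
        rw [CliffordAlgebra.contractLeft_algebraMap, map_zero, zero_mul]
        have h0 : inc n R (0, x.2) * fprod n R L = 0 := by
          rw [inc_inr_eq_sum, Finset.sum_mul]
          refine Finset.sum_eq_zero fun i _ => ?_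
          rw [smul_mul_assoc, f_mul_fprod (hL i), smul_zero]
        have h1 : extInl n R (algebraMap R _ r) = algebraMap R _ r := AlgHom.commutes _ _
        rw [h1, ← mul_assoc, ← Algebra.commutes, mul_assoc, h0, mul_zero]
      | add a b ha hb =>
        rw [map_add, add_mul, mul_add, ha, hb, map_add, map_add, add_mul]
      | ι_mul m a ih =>
        have h1 := contract_ι_mul (pair n R x.2) a m
        have h2 : extInl n R (CliffordAlgebra.ι 0 a * m) =
            inc n R (a, 0) * extInl n R m := by
          rw [map_mul]; congr 1; exact extInl_ι a
        have h3 : inc n R (0, x.2) * inc n R (a, 0) =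
            algebraMap R _ (a ⬝ᵥ x.2) - inc n R (a, 0) * inc n R (0, x.2) := by
          have := CliffordAlgebra.ι_mul_ι_add_swap (Q := q n R) (0, x.2) (a, 0)
          rw [polar_q] at this
          rw [eq_sub_iff_add_eq, this]; simp
        refine Eq.trans ?_ (congrArg (fun t => extInl n R t * fprod n R L) h1.symm)
        rw [h2, mul_assoc, ← mul_assoc (inc n R (0, x.2)), h3, sub_mul, mul_assoc, ih, map_sub,
          map_smul, map_mul, extInl_ι, pair_apply, sub_mul, mul_assoc, Algebra.smul_def, mul_assoc]
    have hx : CliffordAlgebra.ι (q n R) x = inc n R (x.1, 0) + inc n R (0, x.2) := inc_add x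
    rw [fock_inc, hx, add_mul, hb, map_add, map_mul, extInl_ι, add_mul, mul_assoc]
  | mul a b ha hb => rw [mul_assoc, hb, ha, map_mul]; rfl
  | add a b ha hb => rw [add_mul, ha, hb, map_add, LinearMap.add_apply, map_add, add_mul]

theorem fock_injective : Function.Injective (fock n R) := by
  rw [injective_iff_map_eq_zero]
  have := descent (RingHom.id (Cl n R)) {x | fock n R x = 0} ⊥
    (fun x hx i => by
      simp only [Set.mem_ofPred_eq] at hx ⊢
      rw [map_mul, hx, zero_mul])
    (fun x hx i => by
      rw [AddSubgroup.mem_bot] at hx ⊢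
      rw [hx, zero_mul])
    (List.finRange n) (List.nodup_finRange n)
    (fun x hx => by
      have h := mul_extInl_mul_fprod (List.finRange n) List.mem_finRange x (1 : Ext n R)
      rw [Set.mem_ofPred_eq] at hx
      rw [hx, LinearMap.zero_apply, map_zero, zero_mul, map_one, one_mul] at h
      exact h)
  exact this

/-- The subalgebra of `⋀ Rⁿ` generated by the basis vectors with index in `s`. -/
def extSub (n : ℕ) (R : Type*) [CommRing R] (s : Set (Fin n)) : Subalgebra R (Ext n R) :=
  Algebra.adjoin R ((fun i => ExteriorAlgebra.ι R (Pi.single i (1 : R))) '' s)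

theorem contract_mem_extSub (s : Set (Fin n)) (k : Fin n) (m : Ext n R)
    (hm : m ∈ extSub n R (insert k s)) (hk : k ∉ s) :
    CliffordAlgebra.contractLeft (pair n R (Pi.single k 1)) m ∈ extSub n R s := by
  set d : Ext n R →ₗ[R] Ext n R := CliffordAlgebra.contractLeft (pair n R (Pi.single k 1)) with hd
  set E : Fin n → Ext n R := fun i => ExteriorAlgebra.ι R (Pi.single i (1 : R)) with hE
  have hdE : ∀ i m, d (E i * m) = (if i = k then m else 0) - E i * d m := by
    intro i m
    rw [hd, hE, contract_ι_mul, pair_apply]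
    congr 1
    by_cases h : i = k
    · subst h; simp
    · simp [h]
  have hEs : ∀ i ∈ s, E i ∈ extSub n R s := fun i hi => Algebra.subset_adjoin ⟨i, hi, rfl⟩
  suffices h : d m ∈ extSub n R s ∧ m - E k * d m ∈ extSub n R s from h.1
  rw [extSub, ← Subalgebra.mem_toSubmodule, Algebra.adjoin_eq_span] at hm
  induction hm using Submodule.span_induction with
  | mem x hx =>
    induction hx using Submonoid.closure_induction_left with
    | one =>
      have : d 1 = 0 := CliffordAlgebra.contractLeft_one _ _
      rw [this, mul_zero, sub_zero]
      exact ⟨zero_mem _, one_mem _⟩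
    | mul_left x hx y hy ih =>
      obtain ⟨i, hi, rfl⟩ := hx
      change d (E i * y) ∈ _ ∧ E i * y - E k * d (E i * y) ∈ _
      rw [hdE]
      rcases hi with rfl | hi
      · rw [if_pos rfl]
        refine ⟨ih.2, ?_⟩
        rw [mul_sub, ι_mul_ι_mul_self, sub_zero, sub_self]
        exact zero_mem _
      · have hik : i ≠ k := fun h => hk (h ▸ hi)
        rw [if_neg hik, zero_sub]
        refine ⟨neg_mem (mul_mem (hEs i hi) ih.1), ?_⟩
        have h1 : E k * E i = -(E i * E k) :=
          eq_neg_of_add_eq_zero_left (ExteriorAlgebra.ι_add_mul_swap _ _)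
        have h2 : E i * y - E k * -(E i * d y) = E i * (y - E k * d y) := by
          rw [mul_neg, ← mul_assoc, h1, mul_sub, neg_mul, neg_neg, mul_assoc]
        rw [h2]
        exact mul_mem (hEs i hi) ih.2
  | zero => simp
  | add x y _ _ hx hy =>
    rw [map_add]
    refine ⟨add_mem hx.1 hy.1, ?_⟩
    rw [mul_add, add_sub_add_comm]
    exact add_mem hx.2 hy.2
  | smul r x _ hx =>
    rw [map_smul, mul_smul_comm, ← smul_sub]
    exact ⟨Subalgebra.smul_mem _ hx.1 r, Subalgebra.smul_mem _ hx.2 r⟩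

theorem fock_fprod_mem (L : List (Fin n)) (hL : L.Nodup) (s : Set (Fin n)) (hs : ∀ i ∈ L, i ∉ s)
    (m : Ext n R) (hm : m ∈ extSub n R (s ∪ {i | i ∈ L})) :
    fock n R (fprod n R L) m ∈ extSub n R s := by
  induction L generalizing s with
  | nil => simpa [fprod] using hm
  | cons k L ih =>
    rw [List.nodup_cons] at hL
    rw [fprod_cons, map_mul, Module.End.mul_apply, f, fock_inc, map_zero, zero_mul, zero_add]
    refine contract_mem_extSub s k _ ?_ (hs k List.mem_cons_self)
    refine ih hL.2 (insert k s) ?_ ?_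
    · rintro i hi (rfl | hi')
      · exact hL.1 hi
      · exact hs i (List.mem_cons_of_mem _ hi) hi'
    · convert hm using 2
      ext i
      simp only [Set.mem_union, Set.mem_insert_iff, Set.mem_ofPred_eq, List.mem_cons]
      tauto

theorem extSub_univ : extSub n R Set.univ = ⊤ := by
  rw [eq_top_iff]
  intro m _
  induction m using ExteriorAlgebra.induction with
  | algebraMap r => exact Subalgebra.algebraMap_mem _ r
  | ι a =>
    have h : a = ∑ i, a i • Pi.single i (1 : R) := pi_eq_sum_univ' a
    rw [h, map_sum]
    refine sum_mem fun i _ => ?_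
    rw [map_smul]
    exact Subalgebra.smul_mem _ (Algebra.subset_adjoin (Set.mem_image_of_mem _ (Set.mem_univ i))) _
  | mul a b ha hb => exact mul_mem (ha trivial) (hb trivial)
  | add a b ha hb => exact add_mem (ha trivial) (hb trivial)

theorem fock_fprod_scalar (L : List (Fin n)) (hL : L.Nodup) (hL' : ∀ i, i ∈ L) (m : Ext n R) :
    ∃ r : R, fock n R (fprod n R L) m = algebraMap R _ r := by
  have h := fock_fprod_mem L hL ∅ (by simp) m (by
    have : (∅ ∪ {i | i ∈ L} : Set (Fin n)) = Set.univ := by ext i; simp [hL' i]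
    rw [this, extSub_univ]; trivial)
  rw [extSub, Set.image_empty, Algebra.adjoin_empty, Algebra.mem_bot] at h
  obtain ⟨r, hr⟩ := h
  exact ⟨r, hr.symm⟩

theorem fock_surjective : Function.Surjective (fock n R) := by
  intro T
  have := descent (fock n R).toRingHom Set.univ (fock n R).range.toSubring.toAddSubgroup
    (fun _ _ _ => trivial)
    (fun x hx i => by
      obtain ⟨y, rfl⟩ := hx
      exact ⟨y * e n R i, map_mul _ _ _⟩)
    (List.finRange n) (List.nodup_finRange n)
    (fun T _ => by
      refine ⟨extInl n R (T 1) * fprod n R (List.finRange n), LinearMap.ext fun m => ?_⟩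
      obtain ⟨r, hr⟩ := fock_fprod_scalar (R := R) (List.finRange n) (List.nodup_finRange n)
        List.mem_finRange m
      change fock n R (_ * _) m = T (fock n R _ m)
      rw [map_mul, Module.End.mul_apply, hr, fock_extInl, Algebra.algebraMap_eq_smul_one,
        map_smul, mul_smul_comm, mul_one])
  obtain ⟨y, hy⟩ := this T trivial
  exact ⟨y, hy⟩

/-- The isomorphism `Cl(H(Rⁿ)) ≅ End(⋀ Rⁿ)`. -/
noncomputable def fockEquiv (n : ℕ) (R : Type*) [CommRing R] :
    Cl n R ≃ₐ[R] Module.End R (Ext n R) :=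
  AlgEquiv.ofBijective (fock n R) ⟨fock_injective, fock_surjective⟩

/-! ### The Spin group and its action -/

/-- The Spin group: the even units `g` with `g g* = 1` and `g H(Rⁿ) g⁻¹ = H(Rⁿ)`, where `*` is the
standard involution of the Clifford algebra, given by `x ↦ -x` on vectors. -/
def Spin (n : ℕ) (R : Type*) [CommRing R] : Subgroup (Cl n R)ˣ where
  carrier := {g | (g : Cl n R) ∈ CliffordAlgebra.even (q n R) ∧ (g : Cl n R) * star (g : Cl n R) = 1 ∧
    (fun x : Cl n R => (g : Cl n R) * x * ((g⁻¹ : (Cl n R)ˣ) : Cl n R)) '' Set.range (inc n R) =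
      Set.range (inc n R)}
  one_mem' := by
    refine ⟨one_mem _, by simp, by simp⟩
  mul_mem' := by
    rintro g h ⟨hg1, hg2, hg3⟩ ⟨hh1, hh2, hh3⟩
    refine ⟨mul_mem hg1 hh1, ?_, ?_⟩
    · rw [Units.val_mul, star_mul, mul_assoc, ← mul_assoc (h : Cl n R), hh2, one_mul, hg2]
    · conv_rhs => rw [← hg3, ← hh3, Set.image_image]
      refine Set.image_congr fun x _ => ?_
      simp only [Units.val_mul, mul_inv_rev, mul_assoc]
  inv_mem' := by
    rintro g ⟨hg1, hg2, hg3⟩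
    have h : ((g⁻¹ : (Cl n R)ˣ) : Cl n R) = star (g : Cl n R) := Units.inv_eq_of_mul_eq_one_right hg2
    refine ⟨?_, ?_, ?_⟩
    · rw [h, CliffordAlgebra.star_def]
      exact (CliffordAlgebra.reverse_mem_evenOdd_iff _).2
        ((CliffordAlgebra.involute_mem_evenOdd_iff _).2 hg1)
    · rw [h, star_star, ← h, Units.inv_mul]
    · conv_lhs => rw [← hg3, Set.image_image]
      simp [mul_assoc]

/-- A unit whose conjugation restricts to a bijection of `H(Rⁿ)`. -/
theorem mem_Spin_of (g : (Cl n R)ˣ) (h1 : (g : Cl n R) ∈ CliffordAlgebra.even (q n R))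
    (h2 : (g : Cl n R) * star (g : Cl n R) = 1) (ρ ρ' : V n R → V n R)
    (hρ : ∀ x, (g : Cl n R) * inc n R x = inc n R (ρ x) * g) (hρ' : ∀ x, ρ (ρ' x) = x) :
    g ∈ Spin n R := by
  refine ⟨h1, h2, ?_⟩
  have h : ∀ x, (g : Cl n R) * inc n R x * ((g⁻¹ : (Cl n R)ˣ) : Cl n R) = inc n R (ρ x) := by
    intro x; rw [hρ, mul_assoc, Units.mul_inv, mul_one]
  ext y
  constructor
  · rintro ⟨_, ⟨x, rfl⟩, rfl⟩
    exact ⟨ρ x, (h x).symm⟩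
  · rintro ⟨x, rfl⟩
    exact ⟨_, ⟨ρ' x, rfl⟩, by simp only [h, hρ']⟩

theorem conj_mem_range (g : Spin n R) (x : V n R) :
    (g.1 : Cl n R) * inc n R x * ((g.1⁻¹ : (Cl n R)ˣ) : Cl n R) ∈ LinearMap.range (inc n R) := by
  have h := g.2.2.2
  have : (g.1 : Cl n R) * inc n R x * ((g.1⁻¹ : (Cl n R)ˣ) : Cl n R) ∈ Set.range (inc n R) := by
    rw [← h]; exact ⟨_, ⟨x, rfl⟩, rfl⟩
  exact this

/-- The vector representation `π(g) : H(Rⁿ) → H(Rⁿ)`, `x ↦ g x g⁻¹`, with `H(Rⁿ)` identified with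
its image in the Clifford algebra. -/
noncomputable def vecRep (n : ℕ) (R : Type*) [CommRing R] (g : Spin n R) : V n R →ₗ[R] V n R :=
  (LinearEquiv.ofInjective (inc n R) inc_injective).symm.toLinearMap ∘ₗ
    LinearMap.codRestrict (LinearMap.range (inc n R))
      (LinearMap.mulLeftRight R ((g.1 : Cl n R), ((g.1⁻¹ : (Cl n R)ˣ) : Cl n R)) ∘ₗ inc n R)
      (fun x => conj_mem_range g x)

theorem inc_vecRep (g : Spin n R) (x : V n R) :
    inc n R (vecRep n R g x) =
      (g.1 : Cl n R) * inc n R x * ((g.1⁻¹ : (Cl n R)ˣ) : Cl n R) := by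
  have h := LinearEquiv.apply_symm_apply (LinearEquiv.ofInjective (inc n R) inc_injective)
    ⟨_, conj_mem_range g x⟩
  exact congrArg Subtype.val h

theorem vecRep_eq_of (g : Spin n R) (x y : V n R)
    (h : (g.1 : Cl n R) * inc n R x = inc n R y * (g.1 : Cl n R)) : vecRep n R g x = y := by
  apply inc_injective
  rw [inc_vecRep, h, mul_assoc, Units.mul_inv, mul_one]

theorem q_vecRep (g : Spin n R) (x : V n R) : q n R (vecRep n R g x) = q n R x := by
  apply algebraMap_injective (n := n)
  rw [← CliffordAlgebra.ι_sq_scalar, ← CliffordAlgebra.ι_sq_scalar]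
  have h := inc_vecRep g x
  rw [inc] at h
  rw [h]
  have : ∀ a : Cl n R, (g.1 : Cl n R) * a * ((g.1⁻¹ : (Cl n R)ˣ) : Cl n R) *
      ((g.1 : Cl n R) * a * ((g.1⁻¹ : (Cl n R)ˣ) : Cl n R)) =
      (g.1 : Cl n R) * (a * a) * ((g.1⁻¹ : (Cl n R)ˣ) : Cl n R) := by
    intro a; simp [mul_assoc]
  rw [this, CliffordAlgebra.ι_sq_scalar, ← Algebra.commutes, mul_assoc, Units.mul_inv, mul_one]

/-- The action of the Spin group on unit vectors through the vector representation. -/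
noncomputable instance : MulAction (Spin n R) (UnitVec n R) where
  smul g x := ⟨vecRep n R g x.1, by rw [q_vecRep]; exact x.2⟩
  one_smul x := Subtype.ext (vecRep_eq_of _ _ _ (by simp))
  mul_smul g h x := Subtype.ext (vecRep_eq_of _ _ _ (by
    change _ = inc n R (vecRep n R g (vecRep n R h x.1)) * _
    rw [inc_vecRep, inc_vecRep]
    simp [mul_assoc]))

theorem UnitVec.coe_smul (g : Spin n R) (x : UnitVec n R) : (g • x).1 = vecRep n R g x.1 := rfl

/-! ### Elementary elements -/

theorem transvection_conj (x y z : V n R) (hx : q n R x = 0) (hy : q n R y = 0)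
    (hxy : QuadraticMap.polar (q n R) x y = 0) :
    (1 + inc n R x * inc n R y) * inc n R z =
      inc n R (z + QuadraticMap.polar (q n R) y z • x - QuadraticMap.polar (q n R) x z • y) *
        (1 + inc n R x * inc n R y) := by
  have a1 : inc n R x * inc n R x = 0 := by rw [inc, CliffordAlgebra.ι_sq_scalar, hx, map_zero]
  have a2 : inc n R y * inc n R y = 0 := by rw [inc, CliffordAlgebra.ι_sq_scalar, hy, map_zero]
  have a3 := inc_anticomm x y hxy
  have a4 : inc n R y * inc n R z = QuadraticMap.polar (q n R) y z • 1 - inc n R z * inc n R y := by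
    rw [← Algebra.algebraMap_eq_smul_one, ← CliffordAlgebra.ι_mul_ι_add_swap]; simp
  have a5 : inc n R x * inc n R z = QuadraticMap.polar (q n R) x z • 1 - inc n R z * inc n R x := by
    rw [← Algebra.algebraMap_eq_smul_one, ← CliffordAlgebra.ι_mul_ι_add_swap]; simp
  have a6 : inc n R x * (inc n R x * inc n R y) = 0 := by rw [← mul_assoc, a1, zero_mul]
  have a7 : inc n R y * (inc n R x * inc n R y) = 0 := by
    rw [a3, mul_neg, ← mul_assoc, a2, zero_mul, neg_zero]
  rw [add_mul, one_mul, mul_assoc, a4, mul_sub, ← mul_assoc (inc n R x) (inc n R z), a5]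
  simp only [map_sub, map_add, map_smul, add_mul, mul_add, sub_mul, one_mul, mul_one,
    smul_mul_assoc, mul_smul_comm, a6, a7, smul_zero, mul_assoc]
  abel

/-- For isotropic orthogonal vectors `x, y`, the element `1 + x y` of the Spin group. -/
def transvection (x y : V n R) (hx : q n R x = 0) (hy : q n R y = 0)
    (hxy : QuadraticMap.polar (q n R) x y = 0) : Spin n R :=
  have a1 : inc n R x * inc n R x = 0 := by rw [inc, CliffordAlgebra.ι_sq_scalar, hx, map_zero]
  have a3 := inc_anticomm x y hxy
  have a6 : inc n R x * inc n R y * (inc n R x * inc n R y) = 0 := by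
    nth_rewrite 1 [a3]
    rw [neg_mul, mul_assoc, ← mul_assoc (inc n R x), a1, zero_mul, mul_zero, neg_zero]
  ⟨⟨1 + inc n R x * inc n R y, 1 - inc n R x * inc n R y,
    by rw [add_mul, mul_sub, mul_sub, a6]; simp, by rw [sub_mul, mul_add, mul_add, a6]; simp⟩,
   mem_Spin_of _ (add_mem (one_mem _) (CliffordAlgebra.ι_mul_ι_mem_evenOdd_zero _ _ _))
    (by
      rw [star_add, star_mul, star_one, CliffordAlgebra.star_ι, CliffordAlgebra.star_ι, neg_mul_neg,
        inc_anticomm y x (by rw [QuadraticMap.polar_comm]; exact hxy), ← sub_eq_add_neg]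
      rw [add_mul, mul_sub, mul_sub, a6]; simp)
    (fun z => z + QuadraticMap.polar (q n R) y z • x - QuadraticMap.polar (q n R) x z • y)
    (fun z => z - QuadraticMap.polar (q n R) y z • x + QuadraticMap.polar (q n R) x z • y)
    (fun z => transvection_conj x y z hx hy hxy)
    (fun z => by
      have hxx : QuadraticMap.polar (q n R) x x = 0 := by
        rw [QuadraticMap.polar_self, hx, smul_zero]
      have hyy : QuadraticMap.polar (q n R) y y = 0 := by
        rw [QuadraticMap.polar_self, hy, smul_zero]
      have hyx : QuadraticMap.polar (q n R) y x = 0 := by rw [QuadraticMap.polar_comm]; exact hxy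
      simp only [QuadraticMap.polar_add_right, QuadraticMap.polar_sub_right,
        QuadraticMap.polar_smul_right, hxx, hyy, hxy, hyx, smul_zero, sub_zero, add_zero]
      abel)⟩

/-- The hyperbolic basis `e₁, …, eₙ, f₁, …, fₙ` of `H(Rⁿ)`. -/
def hypBasis (n : ℕ) (R : Type*) [CommRing R] : Fin n ⊕ Fin n → V n R
  | Sum.inl i => (Pi.single i 1, 0)
  | Sum.inr i => (0, Pi.single i 1)

theorem q_hypBasis (s : Fin n ⊕ Fin n) : q n R (hypBasis n R s) = 0 := by
  rw [q_apply]; rcases s with i | i <;> simp [hypBasis]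

theorem polar_hypBasis (s t : Fin n ⊕ Fin n) (h : t ≠ s.swap) :
    QuadraticMap.polar (q n R) (hypBasis n R s) (hypBasis n R t) = 0 := by
  rw [polar_q]
  rcases s with i | i <;> rcases t with j | j <;> simp [hypBasis, Pi.single_apply] at h ⊢
  · exact fun h' => (h h').elim
  · exact fun h' => (h h'.symm).elim

/-- The elementary Spin group: the subgroup generated by the elements `1 + r x y`, where `r ∈ R` and
`x, y` are distinct orthogonal vectors of the hyperbolic basis, i.e. by all `1 + r eᵢ eⱼ`,
`1 + r eᵢ fⱼ` and `1 + r fᵢ fⱼ` with `i ≠ j`. -/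
def Epin (n : ℕ) (R : Type*) [CommRing R] : Subgroup (Spin n R) :=
  Subgroup.closure {g | ∃ (s t : Fin n ⊕ Fin n) (r : R), t ≠ s ∧ t ≠ s.swap ∧
    ((g : (Cl n R)ˣ) : Cl n R) = 1 + r • (inc n R (hypBasis n R s) * inc n R (hypBasis n R t))}

/-- All the generators in the definition of the elementary Spin group do lie in the Spin group. -/
theorem exists_elementary (s t : Fin n ⊕ Fin n) (r : R) (h : t ≠ s) (h' : t ≠ s.swap) :
    ∃ g ∈ Epin n R, ((g : (Cl n R)ˣ) : Cl n R) =
      1 + r • (inc n R (hypBasis n R s) * inc n R (hypBasis n R t)) := by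
  have hg : (((transvection (r • hypBasis n R s) (hypBasis n R t)
      (by rw [QuadraticMap.map_smul, q_hypBasis, smul_zero]) (q_hypBasis t)
      (by rw [QuadraticMap.polar_smul_left, polar_hypBasis s t h', smul_zero]) : Spin n R) :
        (Cl n R)ˣ) : Cl n R) =
      1 + r • (inc n R (hypBasis n R s) * inc n R (hypBasis n R t)) := by
    change 1 + inc n R _ * inc n R _ = _
    rw [map_smul, smul_mul_assoc]
  exact ⟨_, Subgroup.subset_closure ⟨s, t, r, h, h', hg⟩, hg⟩

/-! ### The homomorphism `∧ : SLₙ(R) → Spin₂ₙ(R)` -/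

/-- The contragredient action of `SLₙ(R)` on `H(Rⁿ)`: `H(σ)(a, b) = (σ a, (σᵗ)⁻¹ b)`. -/
def hyp (σ : Matrix.SpecialLinearGroup (Fin n) R) (x : V n R) : V n R :=
  (σ.1 *ᵥ x.1, (σ⁻¹).1ᵀ *ᵥ x.2)

theorem hyp_hyp_inv (σ : Matrix.SpecialLinearGroup (Fin n) R) (x : V n R) :
    hyp σ (hyp σ⁻¹ x) = x := by
  have h := inv_mul_val σ⁻¹
  rw [inv_inv] at h
  have h' := inv_mul_val σ⁻¹
  rw [inv_inv] at h'
  refine Prod.ext ?_ ?_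
  · simp only [hyp]; rw [Matrix.mulVec_mulVec, h, Matrix.one_mulVec]
  · simp only [hyp]
    rw [inv_inv, Matrix.mulVec_mulVec, ← Matrix.transpose_mul, h', Matrix.transpose_one,
      Matrix.one_mulVec]

/-- The functorial action `σ ↦ ⋀σ` of `SLₙ(R)` on `⋀ Rⁿ`. -/
def extRep (n : ℕ) (R : Type*) [CommRing R] :
    Matrix.SpecialLinearGroup (Fin n) R →* Module.End R (Ext n R) where
  toFun σ := (ExteriorAlgebra.map (Matrix.mulVecLin σ.1)).toLinearMap
  map_one' := by
    rw [Matrix.SpecialLinearGroup.coe_one, Matrix.mulVecLin_one, ExteriorAlgebra.map_id]; rfl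
  map_mul' σ τ := by
    rw [Matrix.SpecialLinearGroup.coe_mul, Matrix.mulVecLin_mul, ← ExteriorAlgebra.map_comp_map]
    rfl

/-- The units of the Clifford algebra corresponding to `⋀σ` under `Cl(H(Rⁿ)) ≅ End(⋀ Rⁿ)`. -/
noncomputable def wedgeUnits (n : ℕ) (R : Type*) [CommRing R] :
    Matrix.SpecialLinearGroup (Fin n) R →* (Cl n R)ˣ :=
  (Units.map ((fockEquiv n R).symm : Module.End R (Ext n R) →* Cl n R)).comp (extRep n R).toHomUnits

theorem fock_wedgeUnits (σ : Matrix.SpecialLinearGroup (Fin n) R) :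
    fock n R (wedgeUnits n R σ : Cl n R) =
      (ExteriorAlgebra.map (Matrix.mulVecLin σ.1)).toLinearMap :=
  (fockEquiv n R).apply_symm_apply _

theorem map_contract (φ : (Fin n → R) →ₗ[R] (Fin n → R)) (b b' : Fin n → R)
    (h : ∀ a, φ a ⬝ᵥ b' = a ⬝ᵥ b) (m : Ext n R) :
    ExteriorAlgebra.map φ (CliffordAlgebra.contractLeft (pair n R b) m) =
      CliffordAlgebra.contractLeft (pair n R b') (ExteriorAlgebra.map φ m) := by
  induction m using CliffordAlgebra.left_induction with
  | algebraMap r =>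
    have h1 : ExteriorAlgebra.map φ (algebraMap R (Ext n R) r) = algebraMap R _ r :=
      AlgHom.commutes _ _
    refine Eq.trans ?_ (congrArg _ h1.symm)
    refine Eq.trans ?_ (CliffordAlgebra.contractLeft_algebraMap _ _ _).symm
    rw [CliffordAlgebra.contractLeft_algebraMap, map_zero]
  | add x y hx hy => rw [map_add, map_add, hx, hy, map_add, map_add]
  | ι_mul m a ih =>
    have h1 := contract_ι_mul (pair n R b) a m
    have h2 : ExteriorAlgebra.map φ (ExteriorAlgebra.ι R a * m) =
        ExteriorAlgebra.ι R (φ a) * ExteriorAlgebra.map φ m := by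
      rw [map_mul, ExteriorAlgebra.map_apply_ι]
    refine (congrArg _ h1).trans (Eq.trans ?_ (congrArg _ h2.symm))
    rw [contract_ι_mul, map_sub, map_smul, map_mul, ExteriorAlgebra.map_apply_ι, ih, pair_apply,
      pair_apply, h]

theorem map_fock_inc (φ : (Fin n → R) →ₗ[R] (Fin n → R)) (a b b' : Fin n → R)
    (h : ∀ a, φ a ⬝ᵥ b' = a ⬝ᵥ b) (m : Ext n R) :
    ExteriorAlgebra.map φ (fock n R (inc n R (a, b)) m) =
      fock n R (inc n R (φ a, b')) (ExteriorAlgebra.map φ m) := by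
  rw [fock_inc, fock_inc, map_add, map_mul, ExteriorAlgebra.map_apply_ι, map_contract φ b b' h]

/-- Conjugation by `∧σ` is `H(σ)` on `H(Rⁿ)`. -/
theorem wedgeUnits_inc (σ : Matrix.SpecialLinearGroup (Fin n) R) (x : V n R) :
    (wedgeUnits n R σ : Cl n R) * inc n R x = inc n R (hyp σ x) * (wedgeUnits n R σ : Cl n R) := by
  apply fock_injective
  rw [map_mul, map_mul, fock_wedgeUnits]
  refine LinearMap.ext fun m => ?_
  exact map_fock_inc (Matrix.mulVecLin σ.1) x.1 x.2 ((σ⁻¹).1ᵀ *ᵥ x.2)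
    (fun a => dotProduct_contragredient σ a x.2) m

theorem neg_fock (c : Cl n R) (m : Ext n R) :
    ExteriorAlgebra.map (-LinearMap.id) (fock n R c m) =
      fock n R (CliffordAlgebra.involute c) (ExteriorAlgebra.map (-LinearMap.id) m) := by
  induction c using CliffordAlgebra.induction generalizing m with
  | algebraMap r =>
    rw [AlgHom.commutes, AlgHom.commutes, AlgHom.commutes, Module.algebraMap_end_apply,
      Module.algebraMap_end_apply, map_smul]
  | ι x =>
    rw [CliffordAlgebra.involute_ι, ← map_neg]
    exact map_fock_inc (-LinearMap.id) x.1 x.2 (-x.2) (fun a => by simp) m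
  | mul a b ha hb => rw [map_mul, map_mul, map_mul, Module.End.mul_apply, ha, hb]; rfl
  | add a b ha hb =>
    rw [map_add, map_add, map_add, LinearMap.add_apply, map_add, ha, hb]; rfl

theorem involute_wedgeUnits (σ : Matrix.SpecialLinearGroup (Fin n) R) :
    CliffordAlgebra.involute (wedgeUnits n R σ : Cl n R) = wedgeUnits n R σ := by
  apply fock_injective
  refine LinearMap.ext fun m => ?_
  have hnn : ∀ m : Ext n R, ExteriorAlgebra.map (-LinearMap.id)
      (ExteriorAlgebra.map (-LinearMap.id : (Fin n → R) →ₗ[R] (Fin n → R)) m) = m := by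
    intro m
    have : (-LinearMap.id : (Fin n → R) →ₗ[R] (Fin n → R)) ∘ₗ (-LinearMap.id) = LinearMap.id := by
      ext; simp
    rw [← AlgHom.comp_apply, ExteriorAlgebra.map_comp_map, this, ExteriorAlgebra.map_id]; rfl
  have h := neg_fock (wedgeUnits n R σ : Cl n R) (ExteriorAlgebra.map (-LinearMap.id) m)
  rw [hnn] at h
  rw [← h, fock_wedgeUnits]
  simp only [AlgHom.toLinearMap_apply]
  rw [← AlgHom.comp_apply, ExteriorAlgebra.map_comp_map, ← AlgHom.comp_apply,
    ExteriorAlgebra.map_comp_map]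
  congr 2
  ext; simp

theorem mem_even_of_involute [Invertible (2 : R)] (c : Cl n R)
    (h : CliffordAlgebra.involute c = c) : c ∈ CliffordAlgebra.even (q n R) := by
  obtain ⟨a, ha, b, hb, rfl⟩ := Submodule.mem_sup.1
    ((CliffordAlgebra.evenOdd_isCompl (Q := q n R)).sup_eq_top ▸ Submodule.mem_top (x := c))
  rw [map_add, CliffordAlgebra.involute_eq_of_mem_even ha, CliffordAlgebra.involute_eq_of_mem_odd hb,
    add_right_inj] at h
  have h2 : (2 : R) • b = 0 := by rw [two_smul]; nth_rewrite 1 [← h]; simp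
  have hb0 : b = 0 := by
    have := congrArg (fun t => (⅟(2 : R)) • t) h2
    simpa [smul_smul] using this
  rw [hb0, add_zero]
  exact ha

theorem wedge_mul_fprod (σ : Matrix.SpecialLinearGroup (Fin n) R) (L : List (Fin n))
    (hL : L.Nodup) (hL' : ∀ i, i ∈ L) :
    (wedgeUnits n R σ : Cl n R) * fprod n R L = fprod n R L := by
  apply fock_injective
  refine LinearMap.ext fun m => ?_
  obtain ⟨r, hr⟩ := fock_fprod_scalar (R := R) L hL hL' m
  rw [map_mul, Module.End.mul_apply, hr, fock_wedgeUnits]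
  exact AlgHom.commutes _ _

theorem alternating_basis {M : Type*} [AddCommGroup M] [Module R M]
    (g : (Fin n → R) [⋀^Fin n]→ₗ[R] M) (A : Matrix (Fin n) (Fin n) R) :
    g (fun i => A *ᵥ Pi.single i 1) = A.det • g (fun i => Pi.single i 1) := by
  have h : g = (LinearMap.toSpanSingleton R M (g fun i => Pi.single i 1)).compAlternatingMap
      (Matrix.detRowAlternating (n := Fin n) (R := R)) := by
    refine Module.Basis.ext_alternating (Pi.basisFun R (Fin n)) fun v hv => ?_
    let p : Equiv.Perm (Fin n) := Equiv.ofBijective v (Finite.injective_iff_bijective.1 hv)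
    have hp : (fun i => Pi.basisFun R (Fin n) (v i)) =
        (fun i => (Pi.single i 1 : Fin n → R)) ∘ p := by
      funext i; simp [p]
    rw [hp, AlternatingMap.map_perm, AlternatingMap.map_perm]
    congr 1
    have : Matrix.detRowAlternating (fun i => (Pi.single i 1 : Fin n → R)) = (1 : R) := by
      change Matrix.det (fun i => (Pi.single i 1 : Fin n → R)) = 1
      rw [← Matrix.det_one (n := Fin n) (R := R)]
      congr 1
      ext i j
      simp [Matrix.one_apply, Pi.single_apply, eq_comm]
    simp [this]
  rw [h]
  simp only [LinearMap.compAlternatingMap_apply, LinearMap.toSpanSingleton_apply, smul_smul]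
  congr 1
  have h1 : Matrix.detRowAlternating (fun i => A *ᵥ Pi.single i (1 : R)) = A.det := by
    rw [← Matrix.det_transpose]
    change Matrix.det _ = _
    congr 1
    ext i j
    simp
  have h2 : Matrix.detRowAlternating (fun i => (Pi.single i 1 : Fin n → R)) = (1 : R) := by
    change Matrix.det (fun i => (Pi.single i 1 : Fin n → R)) = 1
    rw [← Matrix.det_one (n := Fin n) (R := R)]
    congr 1
    ext i j
    simp [Matrix.one_apply, Pi.single_apply, eq_comm]
  rw [h1, h2, mul_one]

theorem fprod_mul_wedge (σ : Matrix.SpecialLinearGroup (Fin n) R) :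
    fprod n R (List.finRange n) * (wedgeUnits n R σ : Cl n R) = fprod n R (List.finRange n) := by
  have h1 : ∀ L : List (Fin n), (wedgeUnits n R σ : Cl n R) * fprod n R L =
      (L.map fun i => inc n R (0, (σ⁻¹).1ᵀ *ᵥ Pi.single i 1)).prod * wedgeUnits n R σ := by
    intro L
    induction L with
    | nil => simp [fprod]
    | cons k L ih =>
      rw [fprod_cons, ← mul_assoc, f, wedgeUnits_inc, mul_assoc, ih, List.map_cons, List.prod_cons,
        mul_assoc]
      simp [hyp]
  have h2 : ∀ w : Fin n → Fin n → R, ((List.finRange n).map fun i => inc n R (0, w i)).prod =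
      (extInr n R).toLinearMap.compAlternatingMap (ExteriorAlgebra.ιMulti R n) w := by
    intro w
    rw [LinearMap.compAlternatingMap_apply, ExteriorAlgebra.ιMulti_apply, AlgHom.toLinearMap_apply,
      map_list_prod, List.ofFn_eq_map, List.map_map]
    congr 2
    funext i
    exact (extInr_ι _).symm
  have h3 := h1 (List.finRange n)
  rw [h2, alternating_basis, Matrix.det_transpose, (σ⁻¹).2, one_smul, ← h2] at h3
  have h4 := wedge_mul_fprod σ (List.finRange n) (List.nodup_finRange n) List.mem_finRange
  exact h3.symm.trans h4

theorem star_fprod (L : List (Fin n)) :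
    star (fprod n R L) = (-1) ^ L.length * fprod n R L.reverse := by
  induction L with
  | nil => simp [fprod]
  | cons k L ih =>
    have h : star (f n R k) = -f n R k := CliffordAlgebra.star_ι _
    have h' : fprod n R (L.reverse ++ [k]) = fprod n R L.reverse * f n R k := by simp [fprod]
    rw [fprod_cons, star_mul, ih, h, List.reverse_cons, h', List.length_cons, pow_succ]
    simp [mul_assoc]

theorem wedgeUnits_mul_star (σ : Matrix.SpecialLinearGroup (Fin n) R) :
    (wedgeUnits n R σ : Cl n R) * star (wedgeUnits n R σ : Cl n R) = 1 := by
  set g : (Cl n R)ˣ := wedgeUnits n R σ with hg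
  set P := fprod n R (List.finRange n).reverse with hP
  have hstar : ∀ x, inc n R x * star (g : Cl n R) = star (g : Cl n R) * inc n R (hyp σ x) := by
    intro x
    have h := congrArg star (wedgeUnits_inc σ x)
    rw [star_mul, star_mul, CliffordAlgebra.star_ι, CliffordAlgebra.star_ι, neg_mul, mul_neg,
      neg_inj] at h
    exact h
  have hcomm : ∀ c : Cl n R, star (g : Cl n R) * g * c = c * (star (g : Cl n R) * g) := by
    intro c
    induction c using CliffordAlgebra.induction with
    | algebraMap r => exact (Algebra.commutes r _).symm
    | ι x =>
      change star (g : Cl n R) * g * inc n R x = inc n R x * _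
      rw [mul_assoc, wedgeUnits_inc, ← mul_assoc, ← hstar, mul_assoc]
    | mul a b ha hb => rw [← mul_assoc, ha, mul_assoc, hb, mul_assoc]
    | add a b ha hb => rw [mul_add, add_mul, ha, hb]
  have hgP : (g : Cl n R) * P = P :=
    wedge_mul_fprod σ _ (List.nodup_reverse.2 (List.nodup_finRange n)) (by simp)
  have hsP : star (g : Cl n R) * P = P := by
    have h := congrArg star (fprod_mul_wedge σ)
    rw [star_mul, star_fprod] at h
    rcases neg_one_pow_eq_or (Cl n R) (List.finRange n).length with hs | hs
    · rw [hs, one_mul] at h; exact h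
    · rw [hs, neg_one_mul, mul_neg, neg_inj] at h; exact h
  have hone : star (g : Cl n R) * g = 1 := by
    have := descent (RingHom.id (Cl n R)) (Set.range fun y => (star (g : Cl n R) * g - 1) * y) ⊥
      (by
        rintro _ ⟨y, rfl⟩ i
        exact ⟨y * e n R i, by simp only [RingHom.id_apply, mul_assoc]⟩)
      (fun x hx i => by
        rw [AddSubgroup.mem_bot] at hx ⊢
        rw [hx, zero_mul])
      (List.finRange n).reverse (List.nodup_reverse.2 (List.nodup_finRange n))
      (by
        rintro _ ⟨y, rfl⟩
        rw [AddSubgroup.mem_bot]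
        change (star (g : Cl n R) * g - 1) * y * P = 0
        rw [sub_mul, hcomm, one_mul, sub_mul, mul_assoc, mul_assoc, hgP, hsP, sub_self])
    have h0 := this _ ⟨1, rfl⟩
    simp only [AddSubgroup.mem_bot, mul_one] at h0
    exact sub_eq_zero.1 h0
  have hinv : star (g : Cl n R) = ((g⁻¹ : (Cl n R)ˣ) : Cl n R) :=
    (Units.inv_eq_of_mul_eq_one_left hone).symm
  rw [hinv, Units.mul_inv]

theorem wedgeUnits_mem [Invertible (2 : R)] (σ : Matrix.SpecialLinearGroup (Fin n) R) :
    wedgeUnits n R σ ∈ Spin n R :=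
  mem_Spin_of _ (mem_even_of_involute _ (involute_wedgeUnits σ)) (wedgeUnits_mul_star σ)
    (hyp σ) (hyp σ⁻¹) (wedgeUnits_inc σ) (hyp_hyp_inv σ)

/-- The homomorphism `∧ : SLₙ(R) → Spin₂ₙ(R)`: the element `∧σ` corresponds to the automorphism
`⋀σ` of `⋀ Rⁿ` under `Cl(H(Rⁿ)) ≅ End(⋀ Rⁿ)`. -/
noncomputable def wedge (n : ℕ) (R : Type*) [CommRing R] [Invertible (2 : R)] :
    Matrix.SpecialLinearGroup (Fin n) R →* Spin n R :=
  (wedgeUnits n R).codRestrict (Spin n R) wedgeUnits_mem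

/-- `∧` lifts `H : SLₙ(R) → SO₂ₙ(R)` along the vector representation. -/
theorem vecRep_wedge [Invertible (2 : R)] (σ : Matrix.SpecialLinearGroup (Fin n) R) (x : V n R) :
    vecRep n R (wedge n R σ) x = hyp σ x :=
  vecRep_eq_of _ _ _ (wedgeUnits_inc σ x)

/-! ### The comparison map -/

/-- The orbit space `Umₙ(R)/SLₙ(R)`. -/
abbrev UmOrbits (n : ℕ) (R : Type*) [CommRing R] : Type _ :=
  MulAction.orbitRel.Quotient (Matrix.SpecialLinearGroup (Fin n) R) (Um n R)

/-- The orbit space `U_{2n-1}(R)/Spin₂ₙ(R)`. -/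
abbrev UnitVecOrbits (n : ℕ) (R : Type*) [CommRing R] : Type _ :=
  MulAction.orbitRel.Quotient (Spin n R) (UnitVec n R)

/-- Two unit vectors with the same first component are in the same Spin orbit. -/
theorem exists_spin_smul_eq (x y : UnitVec n R) (h : x.1.1 = y.1.1) :
    ∃ g : Spin n R, g • x = y := by
  obtain ⟨⟨v, w⟩, hx⟩ := x
  obtain ⟨⟨v', w'⟩, hy⟩ := y
  obtain rfl : v = v' := h
  rw [q_apply] at hx hy
  simp only at hx hy
  refine ⟨transvection (0, w' - w) (0, w) (by rw [q_apply]; simp) (by rw [q_apply]; simp)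
    (by rw [polar_q]; simp), Subtype.ext (vecRep_eq_of _ _ _ ?_)⟩
  refine (transvection_conj _ _ _ (by rw [q_apply]; simp) (by rw [q_apply]; simp)
    (by rw [polar_q]; simp)).trans ?_
  congr 2
  rw [polar_q, polar_q]
  simp [dotProduct_sub, hx, hy]

/-- The natural map `Umₙ(R)/SLₙ(R) → U_{2n-1}(R)/Spin₂ₙ(R)`, sending the orbit of `v` to the orbit
of `(v, w)` for any `w` with `∑ vᵢ wᵢ = 1`. -/
noncomputable def comparisonMap (n : ℕ) (R : Type*) [CommRing R] [Invertible (2 : R)] :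
    UmOrbits n R → UnitVecOrbits n R :=
  Quotient.lift
    (fun v : Um n R => (Quotient.mk _ (⟨(v.1, ((span_range_eq_top_iff v.1).1 v.2).choose),
      ((span_range_eq_top_iff v.1).1 v.2).choose_spec⟩ : UnitVec n R) : UnitVecOrbits n R))
    (fun v v' h => by
      obtain ⟨σ, rfl⟩ := MulAction.orbitRel_apply.1 h
      refine Quotient.sound (MulAction.orbitRel_apply.2 ?_)
      set x : UnitVec n R := ⟨(v'.1, ((span_range_eq_top_iff v'.1).1 v'.2).choose),
        ((span_range_eq_top_iff v'.1).1 v'.2).choose_spec⟩ with hx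
      obtain ⟨g, hg⟩ := exists_spin_smul_eq (wedge n R σ • x)
        ⟨((σ • v').1, ((span_range_eq_top_iff _).1 (σ • v').2).choose),
        ((span_range_eq_top_iff _).1 (σ • v').2).choose_spec⟩
        (by rw [UnitVec.coe_smul, vecRep_wedge]; rfl)
      exact ⟨g * wedge n R σ, by rw [← hg]; exact mul_smul _ _ _⟩)

/-- The comparison map does not depend on the choice of `w`. -/
theorem comparisonMap_mk [Invertible (2 : R)] (v : Um n R) (x : UnitVec n R) (h : x.1.1 = v.1) :
    comparisonMap n R (Quotient.mk _ v) = Quotient.mk _ x :=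
  Quotient.sound (MulAction.orbitRel_apply.2 (by
    obtain ⟨g, hg⟩ := exists_spin_smul_eq x ⟨(v.1, ((span_range_eq_top_iff v.1).1 v.2).choose),
      ((span_range_eq_top_iff v.1).1 v.2).choose_spec⟩ h
    exact ⟨g, hg⟩))

/-! ### Stabilizers and the base point -/

/-- The stabilizer of a unit vector in the Spin group. -/
noncomputable abbrev St (x : UnitVec n R) : Subgroup (Spin n R) := MulAction.stabilizer (Spin n R) x

/-- The unit vector `uₙ = (eₙ, eₙ)` with `eₙ = (1, 0, …, 0)`. -/
def baseVec (n : ℕ) (R : Type*) [CommRing R] (hn : 0 < n) : UnitVec n R :=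
  ⟨(Pi.single ⟨0, hn⟩ 1, Pi.single ⟨0, hn⟩ 1), by rw [q_apply]; simp⟩

end SpinOrbit

namespace SpinOrbit

open scoped Matrix

/-! Everything reduces to one pointwise statement: for a unit vector `x` and a Spin element `g`, the
first components of `g • x` and `x` lie in the same `SLₙ(R)`-orbit exactly when `g ∈ ∧(SLₙ(R))
Epin₂ₙ(R) St(x)`. The two directions are `mk_toUm_smul` and `mem_mul_of_mk_toUm`.

The inclusion from right to left rests on `exists_SL_of_mem_Epin`. An elementary Spin element need
not preserve the first summand, but its effect on the first component of one given unit vector is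
that of some matrix of determinant one, which may depend on that vector. The delicate generators are
`1 + r εᵢεⱼ`: they move `(v, w)` to a vector with first component `v + u`, where `u` is orthogonal
to `w`. As `w ⬝ v = 1`, this equals `(1 + u wᵗ) v`, and `det (1 + u wᵗ) = 1 + w ⬝ u = 1`.

The other inclusion rests on `exists_Epin_smul_eq`: if `(v, w)` and `(v, w')` are unit vectors,
conjugation by `1 + (0, w' - w)(0, w)` carries one to the other, and this element is a product of
generators `1 + r φᵢφⱼ`. Once `∧σ` has matched the first components, an elementary element thus
corrects the second ones, and what remains fixes `x`.

Injectivity of the comparison map says that a Spin element never changes the `SLₙ(R)`-orbit of a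
first component, which is the factorization at every `x`. For triviality a single base point
suffices, because the Spin group is then transitive on unit vectors. -/

section

variable {n : ℕ} {R : Type*} [CommRing R]

/-! ### Elementary Spin elements acting on first components -/

/-- For `u` orthogonal to `w`, the map `v ↦ v + (w ⬝ v) u` is given by a matrix of determinant
one. -/
theorem exists_SL_mulVec_eq_add (u w : Fin n → R) (h : w ⬝ᵥ u = 0) :
    ∃ σ : Matrix.SpecialLinearGroup (Fin n) R, ∀ v, σ.1 *ᵥ v = v + (w ⬝ᵥ v) • u := by
  -- A rank-one perturbation of the identity: its determinant is `1 + w ⬝ u`.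
  refine ⟨⟨1 + Matrix.vecMulVec u w, ?_⟩, fun v => ?_⟩
  · rw [Matrix.vecMulVec_eq Unit, Matrix.det_one_add_replicateCol_mul_replicateRow, h, add_zero]
  · rw [Matrix.add_mulVec, Matrix.one_mulVec, Matrix.vecMulVec_mulVec]
    simp

/-- An elementary element acts on the first component of a unit vector by a matrix of determinant
one. -/
theorem exists_SL_of_elementary (g : Spin n R) (s t : Fin n ⊕ Fin n) (r : R) (h : t ≠ s)
    (h' : t ≠ s.swap)
    (hg : ((g : (Cl n R)ˣ) : Cl n R) =
      1 + r • (inc n R (hypBasis n R s) * inc n R (hypBasis n R t))) (x : UnitVec n R) :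
    ∃ σ : Matrix.SpecialLinearGroup (Fin n) R, (g • x).1.1 = σ.1 *ᵥ x.1.1 := by
  have hs : q n R (r • hypBasis n R s) = 0 := by
    rw [QuadraticMap.map_smul, q_hypBasis, smul_zero]
  have hst : QuadraticMap.polar (q n R) (r • hypBasis n R s) (hypBasis n R t) = 0 := by
    rw [QuadraticMap.polar_smul_left, polar_hypBasis s t h', smul_zero]
  -- With `r` absorbed into the first factor, `g` is `1 + x y` for isotropic orthogonal vectors, so
  -- conjugation by it has an explicit formula.
  have hgx := vecRep_eq_of g x.1 _ (by
    rw [hg, ← smul_mul_assoc, ← map_smul]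
    exact transvection_conj _ _ x.1 hs (q_hypBasis t) hst)
  have hx := x.2
  rw [UnitVec.coe_smul, hgx]
  generalize x.1 = z at hx ⊢
  obtain ⟨v, w⟩ := z
  rw [q_apply] at hx
  simp only at hx
  rcases s with i | i <;> rcases t with j | j <;> simp only [polar_q, hypBasis]
  -- Type `εᵢεⱼ`: the displacement `r (wⱼ eᵢ - wᵢ eⱼ)` involves `w` rather than `v`, so it is not
  -- linear in `v`. It is orthogonal to `w`, and `w ⬝ v = 1` allows it to be multiplied by `w ⬝ v`.
  · obtain ⟨σ, hσ⟩ := exists_SL_mulVec_eq_add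
      (r • (w j • Pi.single i 1 - w i • Pi.single j 1)) w (by
        simp [mul_comm])
    refine ⟨σ, ?_⟩
    rw [hσ, dotProduct_comm w v, hx]
    simp [smul_sub, add_sub_assoc, smul_smul, mul_comm]
  -- Type `εᵢφⱼ`: an elementary matrix, `v ↦ v + r vⱼ eᵢ`.
  · have hij : j ≠ i := fun e => h' (by rw [e]; rfl)
    obtain ⟨σ, hσ⟩ := exists_SL_mulVec_eq_add (Pi.single i r) (Pi.single j (1 : R))
      (by simp [hij])
    exact ⟨σ, by rw [hσ]; simp [← Pi.single_smul']⟩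
  -- Type `φᵢεⱼ`: again an elementary matrix, `v ↦ v - r vᵢ eⱼ`.
  · have hij : j ≠ i := fun e => h' (by rw [e]; rfl)
    obtain ⟨σ, hσ⟩ := exists_SL_mulVec_eq_add (-Pi.single j r) (Pi.single i (1 : R))
      (by simp [hij.symm])
    exact ⟨σ, by rw [hσ]; simp [sub_eq_add_neg, ← Pi.single_smul', mul_comm]⟩
  -- Type `φᵢφⱼ`: only the second component moves.
  · exact ⟨1, by simp⟩

/-- The elementary Spin group acts on the first component of a unit vector by matrices of
determinant one. -/
theorem exists_SL_of_mem_Epin {g : Spin n R} (hg : g ∈ Epin n R) (x : UnitVec n R) :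
    ∃ σ : Matrix.SpecialLinearGroup (Fin n) R, (g • x).1.1 = σ.1 *ᵥ x.1.1 := by
  induction hg using Subgroup.closure_induction generalizing x with
  | mem g hg =>
    obtain ⟨s, t, r, h, h', hg⟩ := hg
    exact exists_SL_of_elementary g s t r h h' hg x
  | one => exact ⟨1, by simp⟩
  | mul g k _ _ hg hk =>
    -- The matrix attached to `g` depends on the vector, so it is taken at `k • x`; the induction
    -- must therefore range over all `x`.
    obtain ⟨σ, hσ⟩ := hg (k • x)
    obtain ⟨τ, hτ⟩ := hk x
    refine ⟨σ * τ, ?_⟩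
    rw [mul_smul, hσ, hτ, Matrix.mulVec_mulVec, Matrix.SpecialLinearGroup.coe_mul]
  | inv g _ hg =>
    obtain ⟨σ, hσ⟩ := hg (g⁻¹ • x)
    refine ⟨σ⁻¹, ?_⟩
    rw [smul_inv_smul] at hσ
    rw [hσ, Matrix.mulVec_mulVec, inv_mul_val, Matrix.one_mulVec]

/-! ### Elementary elements from the second summand -/

theorem inc_inr_mul_self (b : Fin n → R) : inc n R (0, b) * inc n R (0, b) = 0 := by
  rw [inc, CliffordAlgebra.ι_sq_scalar, q_apply]; simp

theorem inc_inr_anticomm (b c : Fin n → R) :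
    inc n R (0, b) * inc n R (0, c) = -(inc n R (0, c) * inc n R (0, b)) :=
  inc_anticomm _ _ (by rw [polar_q]; simp)

/-- The cross term `b c b d = -b b c d` vanishes because `b² = 0`. Hence `c ↦ 1 + b c` turns sums
into products, which permits expansion in a basis. -/
theorem one_add_mul_one_add_inr (b c d : Fin n → R) :
    (1 + inc n R (0, b) * inc n R (0, c)) * (1 + inc n R (0, b) * inc n R (0, d)) =
      1 + inc n R (0, b) * inc n R (0, c + d) := by
  have h : ((0, c + d) : V n R) = (0, c) + (0, d) := by simp
  have h1 : inc n R (0, b) * inc n R (0, c) * (inc n R (0, b) * inc n R (0, d)) = 0 := by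
    rw [inc_inr_anticomm b c, neg_mul, mul_assoc, ← mul_assoc (inc n R (0, b)), inc_inr_mul_self,
      zero_mul, mul_zero, neg_zero]
  rw [h, map_add, add_mul, mul_add, mul_add, mul_add, h1, one_mul, one_mul, mul_one]
  abel

/-- A product of elements `1 + b cᵢ` of the elementary Spin group is again elementary. -/
theorem exists_Epin_sum {b : Fin n → R} {ι : Type*} (s : Finset ι) (c : ι → Fin n → R)
    (h : ∀ i ∈ s, ∃ g ∈ Epin n R, ((g : (Cl n R)ˣ) : Cl n R) =
      1 + inc n R (0, b) * inc n R (0, c i)) :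
    ∃ g ∈ Epin n R, ((g : (Cl n R)ˣ) : Cl n R) =
      1 + inc n R (0, b) * inc n R (0, ∑ i ∈ s, c i) := by
  classical
  induction s using Finset.induction_on with
  | empty =>
    refine ⟨1, one_mem _, ?_⟩
    have : ((0, 0) : V n R) = 0 := rfl
    simp [this]
  | insert i s hi ih =>
    obtain ⟨g, hg, hg'⟩ := ih fun j hj => h j (Finset.mem_insert_of_mem hj)
    obtain ⟨k, hk, hk'⟩ := h i (Finset.mem_insert_self i s)
    refine ⟨k * g, mul_mem hk hg, ?_⟩
    rw [Finset.sum_insert hi, ← one_add_mul_one_add_inr, ← hk', ← hg']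
    rfl

/-- The elements `1 + b c` with `b, c` in the second summand are elementary. -/
theorem exists_Epin_inr (b c : Fin n → R) :
    ∃ g ∈ Epin n R, ((g : (Cl n R)ˣ) : Cl n R) = 1 + inc n R (0, b) * inc n R (0, c) := by
  -- By anticommutation `1 + c b = 1 - b c`, which is the inverse of `1 + b c`.
  have swap : ∀ {b c : Fin n → R}, (∃ g ∈ Epin n R, ((g : (Cl n R)ˣ) : Cl n R) =
      1 + inc n R (0, b) * inc n R (0, c)) → ∃ g ∈ Epin n R, ((g : (Cl n R)ˣ) : Cl n R) =
      1 + inc n R (0, c) * inc n R (0, b) := by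
    rintro b c ⟨g, hg, hg'⟩
    refine ⟨g⁻¹, inv_mem hg, ?_⟩
    refine Units.inv_eq_of_mul_eq_one_right ?_
    have h := one_add_mul_one_add_inr b c (-c)
    have h1 : ((0, -c) : V n R) = -(0, c) := by simp
    have h2 : ((0, 0) : V n R) = 0 := rfl
    rw [add_neg_cancel, h2, map_zero, mul_zero, add_zero, h1, map_neg, mul_neg,
      ← inc_inr_anticomm c b] at h
    rw [hg', h]
  have basis : ∀ (i j : Fin n) (r r' : R), ∃ g ∈ Epin n R, ((g : (Cl n R)ˣ) : Cl n R) =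
      1 + inc n R (0, r • Pi.single i 1) * inc n R (0, r' • Pi.single j 1) := by
    intro i j r r'
    have h (k : Fin n) (a : R) : inc n R (0, a • Pi.single k 1) = a • f n R k := by
      rw [f, ← map_smul]; simp
    -- Equal indices give no generator, but then the product is zero since `φᵢ² = 0`.
    by_cases hij : j = i
    · subst hij
      exact ⟨1, one_mem _, by simp [h, f_sq]⟩
    · obtain ⟨g, hg, hg'⟩ := exists_elementary (R := R) (Sum.inr i) (Sum.inr j) (r * r')
        (by simpa using hij) (by simp)
      refine ⟨g, hg, hg'.trans ?_⟩
      rw [h, h, smul_mul_smul_comm]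
      rfl
  have hb : b = ∑ i, b i • Pi.single i (1 : R) := pi_eq_sum_univ' b
  have hc : c = ∑ i, c i • Pi.single i (1 : R) := pi_eq_sum_univ' c
  rw [hc]
  -- Additivity is available only in the second slot: expand `c` there, then swap so that `b` can be
  -- expanded in the same way.
  refine exists_Epin_sum _ _ fun j _ => swap ?_
  rw [hb]
  exact exists_Epin_sum _ _ fun i _ => basis j i _ _

/-- Two unit vectors with the same first component are in the same orbit of the elementary Spin
group. -/
theorem exists_Epin_smul_eq (x y : UnitVec n R) (h : x.1.1 = y.1.1) :
    ∃ g ∈ Epin n R, g • x = y := by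
  obtain ⟨⟨v, w⟩, hx⟩ := x
  obtain ⟨⟨v', w'⟩, hy⟩ := y
  obtain rfl : v = v' := h
  rw [q_apply] at hx hy
  simp only at hx hy
  -- Conjugation adds `(v ⬝ w) (w' - w) - (v ⬝ (w' - w)) w` to the second component. Here `v ⬝ w =
  -- 1` and `v ⬝ (w' - w) = 0`, so `w` becomes `w'`.
  obtain ⟨g, hg, hg'⟩ := exists_Epin_inr (w' - w) w
  refine ⟨g, hg, Subtype.ext (vecRep_eq_of _ _ _ ?_)⟩
  rw [hg']
  refine (transvection_conj _ _ _ (by rw [q_apply]; simp) (by rw [q_apply]; simp)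
    (by rw [polar_q]; simp)).trans ?_
  congr 2
  rw [polar_q, polar_q]
  simp [dotProduct_sub, hx, hy]

/-! ### Orbits of first components and the factorization -/

/-- The unimodular vector underlying a unit vector. -/
def UnitVec.toUm (x : UnitVec n R) : Um n R :=
  ⟨x.1.1, (span_range_eq_top_iff _).2 ⟨x.1.2, x.2⟩⟩

theorem exists_toUm_eq (v : Um n R) : ∃ x : UnitVec n R, x.toUm = v := by
  obtain ⟨w, hw⟩ := (span_range_eq_top_iff _).1 v.2
  exact ⟨⟨(v.1, w), hw⟩, rfl⟩

end

section

open scoped Pointwise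

variable {n : ℕ} {R : Type*} [CommRing R] [Invertible (2 : R)]

/-- Independence of the second component lets `x` itself serve as the lift of its first component,
so the chosen lift in `comparisonMap` never has to be handled. -/
theorem comparisonMap_toUm (x : UnitVec n R) :
    comparisonMap n R (Quotient.mk _ x.toUm) = Quotient.mk _ x :=
  comparisonMap_mk _ _ rfl

theorem comparisonMap_surjective : Function.Surjective (comparisonMap n R) := by
  rintro ⟨x⟩
  exact ⟨_, comparisonMap_toUm x⟩

/-- Elements of `∧(SLₙ(R)) Epin₂ₙ(R) St(x)` do not change the `SLₙ(R)` orbit of the first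
component of `x`. -/
theorem mk_toUm_smul (x : UnitVec n R) (g : Spin n R)
    (hg : g ∈ ((wedge n R).range : Set (Spin n R)) * (Epin n R : Set (Spin n R)) *
      (St x : Set (Spin n R))) :
    (Quotient.mk _ (g • x).toUm : UmOrbits n R) = Quotient.mk _ x.toUm := by
  obtain ⟨_, ⟨_, ⟨σ, rfl⟩, ε, hε, rfl⟩, s, hs, rfl⟩ := hg
  -- The matrix `τ` is valid at `x` only; this suffices because the rightmost factor `s` acts first
  -- and fixes `x`.
  obtain ⟨τ, hτ⟩ := exists_SL_of_mem_Epin hε x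
  refine Quotient.sound (MulAction.orbitRel_apply.2 ⟨σ * τ, Subtype.ext ?_⟩)
  have hs' : s • x = x := hs
  change (σ * τ).1 *ᵥ x.1.1 = ((wedge n R σ * ε * s) • x).1.1
  rw [mul_smul, hs', mul_smul, UnitVec.coe_smul, vecRep_wedge, hyp, hτ, Matrix.mulVec_mulVec,
    Matrix.SpecialLinearGroup.coe_mul]

/-- An element of the Spin group that does not change the `SLₙ(R)` orbit of the first component
of `x` lies in `∧(SLₙ(R)) Epin₂ₙ(R) St(x)`. -/
theorem mem_mul_of_mk_toUm (x : UnitVec n R) (g : Spin n R)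
    (h : (Quotient.mk _ (g • x).toUm : UmOrbits n R) = Quotient.mk _ x.toUm) :
    g ∈ ((wedge n R).range : Set (Spin n R)) * (Epin n R : Set (Spin n R)) *
      (St x : Set (Spin n R)) := by
  obtain ⟨σ, hσ⟩ := MulAction.orbitRel_apply.1 (Quotient.exact h)
  have hσ' : σ.1 *ᵥ x.1.1 = (g • x).1.1 := congrArg Subtype.val hσ
  -- Undoing `∧σ` brings the first component of `g • x` back to that of `x`, so only the second
  -- components can differ.
  obtain ⟨ε, hε, hx⟩ := exists_Epin_smul_eq x ((wedge n R σ)⁻¹ • g • x) (by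
    rw [← map_inv, UnitVec.coe_smul, vecRep_wedge, hyp, ← hσ', Matrix.mulVec_mulVec, inv_mul_val,
      Matrix.one_mulVec])
  -- The stabilizer factor is forced: it is what is left of `g`, and it fixes `x` since `∧σ ε` and
  -- `g` agree at `x`.
  refine ⟨_, ⟨_, ⟨σ, rfl⟩, ε, hε, rfl⟩, (wedge n R σ * ε)⁻¹ * g, ?_, mul_inv_cancel_left _ _⟩
  change ((wedge n R σ * ε)⁻¹ * g) • x = x
  rw [mul_smul, mul_inv_rev, mul_smul, ← hx, inv_smul_smul]

end

end SpinOrbit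

/-! ### The theorem -/

open scoped Pointwise in
theorem mainTheorem6 (n : ℕ) (hn : 3 ≤ n) (R : Type*) [CommRing R] [Invertible (2 : R)] :
    (Function.Injective (SpinOrbit.comparisonMap n R) ↔
      ∀ x : SpinOrbit.UnitVec n R,
        (Set.univ : Set (SpinOrbit.Spin n R)) =
          ((SpinOrbit.wedge n R).range : Set (SpinOrbit.Spin n R)) *
            (SpinOrbit.Epin n R : Set (SpinOrbit.Spin n R)) *
            (SpinOrbit.St x : Set (SpinOrbit.Spin n R))) ∧
    (Function.Injective (SpinOrbit.comparisonMap n R) →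
      Function.Bijective (SpinOrbit.comparisonMap n R)) ∧
    (Nat.card (SpinOrbit.UmOrbits n R) = 1 ↔
      Nat.card (SpinOrbit.UnitVecOrbits n R) = 1 ∧
        (Set.univ : Set (SpinOrbit.Spin n R)) =
          ((SpinOrbit.wedge n R).range : Set (SpinOrbit.Spin n R)) *
            (SpinOrbit.Epin n R : Set (SpinOrbit.Spin n R)) *
            (SpinOrbit.St (SpinOrbit.baseVec n R (by omega)) : Set (SpinOrbit.Spin n R))) := by
  have key : Function.Injective (SpinOrbit.comparisonMap n R) →
      ∀ x : SpinOrbit.UnitVec n R,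
        (Set.univ : Set (SpinOrbit.Spin n R)) =
          ((SpinOrbit.wedge n R).range : Set (SpinOrbit.Spin n R)) *
            (SpinOrbit.Epin n R : Set (SpinOrbit.Spin n R)) *
            (SpinOrbit.St x : Set (SpinOrbit.Spin n R)) := by
    refine fun hinj x => (Set.eq_univ_of_forall fun g => ?_).symm
    refine SpinOrbit.mem_mul_of_mk_toUm x g (hinj ?_)
    rw [SpinOrbit.comparisonMap_toUm, SpinOrbit.comparisonMap_toUm]
    -- The images to be compared are the Spin orbits of `g • x` and `x`, which coincide.
    exact Quotient.sound (MulAction.orbitRel_apply.2 ⟨g, rfl⟩)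
  refine ⟨⟨key, fun h => ?_⟩, fun h => ⟨h, SpinOrbit.comparisonMap_surjective⟩, ⟨fun h => ?_, ?_⟩⟩
  · rintro ⟨v⟩ ⟨v'⟩ hv
    obtain ⟨x, rfl⟩ := SpinOrbit.exists_toUm_eq v
    obtain ⟨y, rfl⟩ := SpinOrbit.exists_toUm_eq v'
    replace hv := ((SpinOrbit.comparisonMap_toUm x).symm.trans hv).trans
      (SpinOrbit.comparisonMap_toUm y)
    obtain ⟨g, rfl⟩ := MulAction.orbitRel_apply.1 (Quotient.exact hv)
    -- Here `x` has become `g • y`, so the factorization of `g` is needed at `y`.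
    exact SpinOrbit.mk_toUm_smul y g (h y ▸ Set.mem_univ g)
  · obtain ⟨h1, h2⟩ := Nat.card_eq_one_iff_unique.1 h
    -- A map from a one-point set is injective, so the first part of the theorem applies and the
    -- bijection transports the cardinality.
    have hinj : Function.Injective (SpinOrbit.comparisonMap n R) :=
      fun _ _ _ => Subsingleton.elim _ _
    refine ⟨?_, key hinj _⟩
    rw [← h]
    exact (Nat.card_congr (Equiv.ofBijective _ ⟨hinj, SpinOrbit.comparisonMap_surjective⟩)).symm
  · rintro ⟨h, hSpin⟩
    obtain ⟨h1, h2⟩ := Nat.card_eq_one_iff_unique.1 h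
    set u := SpinOrbit.baseVec n R (by omega)
    refine Nat.card_eq_one_iff_exists.2 ⟨Quotient.mk _ u.toUm, ?_⟩
    rintro ⟨v⟩
    obtain ⟨x, rfl⟩ := SpinOrbit.exists_toUm_eq v
    have hx : (Quotient.mk _ x : SpinOrbit.UnitVecOrbits n R) = Quotient.mk _ u :=
      Subsingleton.elim _ _
    -- Transitivity writes every unit vector as `g • u`, hence the factorization at `u` alone is
    -- enough.
    obtain ⟨g, rfl⟩ := MulAction.orbitRel_apply.1 (Quotient.exact hx)
    exact SpinOrbit.mk_toUm_smul u g (hSpin ▸ Set.mem_univ g)
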